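/- **Conventions.** Algebras are nonempty, operations have finite arity, a variety is the class of all algebras of a given similarity type that satisfy a given set of identities. For an algebra $A$, $\mathrm{Con}\,A$ is the lattice of congruences of $A$ and $\mathrm{Con}_c A$ is the $(\vee,0)$-semilattice of finitely generated congruences of $A$; $\mathrm{Con}_c$ is a functor, where for a morphism $f\colon A\to B$ the congruence $(\mathrm{Con}_c f)(\alpha)$ is generated by $\{(f(x),f(y)) : (x,y)\in\alpha\}$. A variety $\mathcal W$ is *congruence-proper* if each $A\in\mathcal W$ with $\mathrm{Con}\,A$ finite is finite. For a $P$-indexed diagram $\vec A=(A_p,f_{p,q})_{p\le q\text{ in }P}$ of algebras, a *lifting of $\mathrm{Con}_c\circ\vec A$ in $\mathcal W$* is a $P$-indexed diagram $\vec B$ in $\mathcal W$ with $\mathrm{Con}_c\circ\vec B\cong\mathrm{Con}_c\circ\vec A$ (natural isomorphism). The *critical point* $\mathrm{crit}(\mathcal V;\mathcal W)$ is the least cardinality of a $(\vee,0)$-semilattice isomorphic to $\mathrm{Con}_c A$ for some $A\in\mathcal V$ but not to $\mathrm{Con}_c B$ for any $B\in\mathcal W$, and $\infty$ if there is none. A finite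 subset $V$ of a poset $X$ is a *kernel* if for each $u\in X$ there is a largest $v\in V$ with $v\le u$; we denote it by $V\cdot u$. The poset $X$ is *supported* if each finite subset of $X$ is contained in a kernel. A *norm-covering* of a poset $P$ is a supported poset $X$ with an isotone map $\partial\colon X\to P$. An ideal (nonempty directed lower subset) $\mathbf x$ of $X$ is *sharp* if $\{\partial u: u\in\mathbf x\}$ has a largest element, denoted by $\partial\mathbf x$. An *$\aleph_0$-lifter* of $P$ is a pair $(X,\mathbf X)$ where $X$ is a norm-covering of $P$ and $\mathbf X$ is a set of sharp ideals of $X$, ordered by inclusion, such that, with $\mathbf X^{=}=\{\mathbf x\in\mathbf X:\partial\mathbf x\text{ is not maximal in }P\}$, 1. for each $\mathbf x\in\mathbf X^{=}$ the set $\{\mathbf y\in\mathbf X:\mathbf y\subseteq\mathbf x\}$ is finite; 2. for each map $S$ from $\mathbf X^{=}$ to the finite subsets of $X$ there is an isotone map $\sigma\colon P\to\mathbf X$ such that $\partial\sigma(p)=p$ for all $p\in P$ and $S(\sigma(p))\cap\sigma(q)\subseteq\sigma(p)$ for all $p<q$ in $P$. The *condensate* $\mathbf F(X)\otimes\vec A$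 is the directed colimit, over the kernels $V$ of $X$, of the finite products $\prod_{v\in V}A_{\partial v}$, where for kernels $V\subseteq W$ the transition morphism sends $(a_v)_{v\in V}$ to $(f_{\partial(V\cdot w),\partial w}(a_{V\cdot w}))_{w\in W}$; equivalently, it is the subalgebra of $\prod_{u\in X}A_{\partial u}$ of all $(a_u)_{u\in X}$ for which there is a kernel $V$ with $a_u=f_{\partial(V\cdot u),\partial u}(a_{V\cdot u})$ for all $u\in X$. **Theorem.** Let $\mathcal V$ be a variety of algebras, let $\mathcal W$ be a congruence-proper variety of algebras with a finite similarity type (the similarity types of $\mathcal V$ and $\mathcal W$ may differ), let $(X,\mathbf X)$ be an $\aleph_0$-lifter of a poset $P$, and let $\vec A=(A_p,f_{p,q})_{p\le q\text{ in }P}$ be a diagram in $\mathcal V$. (1) Assume that $\mathrm{Con}_c A_p$ is finite for each non-maximal $p\in P$. Let $B\in\mathcal W$ be such that $\mathrm{Con}_c B\cong\mathrm{Con}_c(\mathbf F(X)\otimes\vec A)$. Then there is a lifting $\vec B$ of $\mathrm{Con}_c\circ\vec A$ in $\mathcal W$ such that $B_p$ is a quotient of $B$ for each $p\in P$. (2)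 Assume that $A_p$ is finite for each $p\in P$, and that $\mathrm{Con}_c\circ\vec A$ has no lifting in $\mathcal W$. Then $\mathrm{crit}(\mathcal V;\mathcal W)\le\aleph_0+\mathrm{card}\,X$. -/

import Mathlib

open FirstOrder FirstOrder.Language.Structure
open scoped Cardinal

universe u

/-! ### Algebras, varieties and congruences

A similarity type is a first-order language without relation symbols: it has symbols of
operations, each of a finite arity (constants are nullary operations).  An algebra is a structure
for that language, a morphism of algebras is a map `A →[L] B`, a term is a `L.Term ℕ`. -/

namespace CondLift

section Congruences

variable (L : FirstOrder.Language.{u, u})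

/-- A variety of algebras of similarity type `L`, presented by the identities `s = t` that define
it. -/
structure Variety where
  identities : Set (L.Term ℕ × L.Term ℕ)

variable {L}

/-- `A` is a member of the variety `V`: algebras are nonempty, and `A` satisfies each identity of
`V` for all values of the variables. -/
def Variety.Mem (V : Variety L) (A : Type u) [L.Structure A] : Prop :=
  Nonempty A ∧ ∀ e ∈ V.identities, ∀ v : ℕ → A, e.1.realize v = e.2.realize v

variable (L)

/-- A congruence of the algebra `A`: an equivalence relation compatible with all operations. -/
@[ext] structure Congr (A : Type u) [L.Structure A] where
  rel : A → A → Prop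
  equiv : Equivalence rel
  compat : ∀ {n : ℕ} (f : L.Functions n) (x y : Fin n → A),
    (∀ i, rel (x i) (y i)) → rel (funMap f x) (funMap f y)

namespace Congr

variable {L} {A B C : Type u} [L.Structure A] [L.Structure B] [L.Structure C]

/-- Congruences are ordered by inclusion. -/
instance : PartialOrder (Congr L A) where
  le α β := ∀ x y, α.rel x y → β.rel x y
  le_refl _ _ _ h := h
  le_trans _ _ _ h h' x y hx := h' x y (h x y hx)
  le_antisymm α β h h' := by
    ext x y
    exact ⟨h x y, h' x y⟩

theorem le_def {α β : Congr L A} : α ≤ β ↔ ∀ x y, α.rel x y → β.rel x y := Iff.rfl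

/-- The infimum of a set of congruences is their intersection. -/
instance : InfSet (Congr L A) where
  sInf S :=
    { rel := fun x y => ∀ α ∈ S, α.rel x y
      equiv :=
        ⟨fun x α _ => α.equiv.refl x, fun h α hα => α.equiv.symm (h α hα),
          fun h h' α hα => α.equiv.trans (h α hα) (h' α hα)⟩
      compat := fun f x y h α hα => α.compat f x y fun i => h i α hα }

/-- The lattice `Con A` of all congruences of `A`. -/
instance : CompleteLattice (Congr L A) :=
  completeLatticeOfInf (Congr L A) fun _ =>
    ⟨fun _ hα _ _ h => h _ hα, fun _ hβ x y h _ hα => hβ hα x y h⟩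

/-- The congruence generated by a binary relation: the smallest congruence containing it. -/
def gen (r : A → A → Prop) : Congr L A := sInf {α | ∀ x y, r x y → α.rel x y}

theorem gen_le {r : A → A → Prop} {β : Congr L A} : gen r ≤ β ↔ ∀ x y, r x y → β.rel x y :=
  ⟨fun h x y hr => h x y fun _ hα => hα x y hr, fun h _ _ hr => hr β h⟩

/-- The principal congruence `Θ_A(a, b)`. -/
def principal (a b : A) : Congr L A := gen fun x y => x = a ∧ y = b

theorem principal_le {a b : A} {β : Congr L A} : principal a b ≤ β ↔ β.rel a b := by
  rw [principal, gen_le]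
  exact ⟨fun h => h a b ⟨rfl, rfl⟩, by rintro h x y ⟨rfl, rfl⟩; exact h⟩

/-- A congruence is finitely generated if it is a finite join of principal congruences. -/
def FG (α : Congr L A) : Prop :=
  ∃ s : Finset (A × A), α = s.sup fun z => principal z.1 z.2

theorem FG.bot : (⊥ : Congr L A).FG := ⟨∅, by simp⟩

theorem FG.sup {α β : Congr L A} (hα : α.FG) (hβ : β.FG) : (α ⊔ β).FG := by
  classical
  obtain ⟨s, rfl⟩ := hα
  obtain ⟨t, rfl⟩ := hβ
  exact ⟨s ∪ t, by rw [Finset.sup_union]⟩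

/-- The inverse image of a congruence under a morphism. -/
def comap (f : A →[L] B) (β : Congr L B) : Congr L A where
  rel x y := β.rel (f x) (f y)
  equiv := ⟨fun _ => β.equiv.refl _, fun h => β.equiv.symm h, fun h h' => β.equiv.trans h h'⟩
  compat g x y h := by
    rw [f.map_fun, f.map_fun]
    exact β.compat g _ _ h

/-- The congruence of `B` generated by the image of the congruence `α` of `A`, that is, by all
pairs `(f x, f y)` with `(x, y) ∈ α`. -/
def map (f : A →[L] B) (α : Congr L A) : Congr L B :=
  gen fun x y => ∃ a b, α.rel a b ∧ f a = x ∧ f b = y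

theorem gc_map_comap (f : A →[L] B) : GaloisConnection (map f) (comap f) := by
  intro α β
  rw [map, gen_le]
  constructor
  · intro h a b hab
    exact h _ _ ⟨a, b, hab, rfl, rfl⟩
  · rintro h _ _ ⟨a, b, hab, rfl, rfl⟩
    exact h a b hab

theorem map_principal (f : A →[L] B) (a b : A) :
    map f (principal a b) = principal (f a) (f b) := by
  apply eq_of_forall_ge_iff
  intro β
  rw [gc_map_comap f, principal_le, principal_le]
  exact Iff.rfl

theorem FG.map {α : Congr L A} (hα : α.FG) (f : A →[L] B) : (α.map f).FG := by
  classical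
  obtain ⟨s, rfl⟩ := hα
  refine ⟨s.image fun z => (f z.1, f z.2), ?_⟩
  induction s using Finset.induction_on with
  | empty => simpa using (gc_map_comap f).l_bot
  | insert z s _ ih =>
    rw [Finset.sup_insert, (gc_map_comap f).l_sup, Finset.image_insert, Finset.sup_insert, ih,
      map_principal]

end Congr

/-- The set `Con_c A` of all finitely generated (that is, compact) congruences of `A`, ordered by
inclusion. -/
abbrev Conc (A : Type u) [L.Structure A] : Type u := {α : Congr L A // α.FG}

namespace Conc

variable {A B : Type u} [L.Structure A] [L.Structure B]

/-- `Con_c A` is a join-semilattice; its joins are the joins in `Con A`. -/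
instance : SemilatticeSup (Conc L A) :=
  Subtype.semilatticeSup fun _ _ hα hβ => hα.sup hβ

/-- The least element of `Con_c A` is the identity congruence. -/
instance : OrderBot (Conc L A) := Subtype.orderBot Congr.FG.bot

variable {L}

/-- The action of the functor `Con_c` on morphisms. -/
def map (f : A →[L] B) (α : Conc L A) : Conc L B := ⟨α.1.map f, α.2.map f⟩

end Conc

variable {L}

/-- A variety is congruence-proper if each of its members with a finite congruence lattice is
finite. -/
def Variety.CongruenceProper (V : Variety L) : Prop :=
  ∀ (A : Type u) [L.Structure A], V.Mem A → Finite (Congr L A) → Finite A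

/-- The `(∨, 0)`-semilattice `S` has a lifting in `V`, that is, `S` belongs to the class
`Con_c V`. -/
def Variety.LiftsSemilattice (V : Variety L) (S : Type u) [SemilatticeSup S] [OrderBot S] : Prop :=
  ∃ (A : Type u) (_ : L.Structure A), V.Mem A ∧ Nonempty (Conc L A ≃o S)

end Congruences

/-- The cardinalities of the members of `(Con_c V) - (Con_c W)`. -/
def critSet {L L' : FirstOrder.Language.{u, u}} (V : Variety L) (W : Variety L') : Set Cardinal.{u} :=
  {κ | ∃ (S : Type u) (_ : SemilatticeSup S) (_ : OrderBot S),
    V.LiftsSemilattice S ∧ ¬ W.LiftsSemilattice S ∧ #S = κ}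

open Classical in
/-- The critical point `crit(V; W)`; the value `⊤` stands for `∞`. -/
noncomputable def crit {L L' : FirstOrder.Language.{u, u}} (V : Variety L) (W : Variety L') :
    WithTop Cardinal.{u} :=
  if (critSet V W).Nonempty then ((sInf (critSet V W) : Cardinal.{u}) : WithTop Cardinal.{u})
  else ⊤

/-! ### Diagrams of algebras -/

/-- A `P`-indexed diagram of algebras of similarity type `L`. -/
structure AlgDiagram (L : FirstOrder.Language.{u, u}) (P : Type u) [PartialOrder P] where
  obj : P → Type u
  str : ∀ p, L.Structure (obj p)
  map : ∀ {p q : P}, p ≤ q → (obj p →[L] obj q)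
  map_id : ∀ (p : P) (x : obj p), map (le_refl p) x = x
  map_comp : ∀ {p q r : P} (h : p ≤ q) (h' : q ≤ r) (x : obj p),
    map h' (map h x) = map (h.trans h') x

attribute [instance] AlgDiagram.str

section Diagrams

variable {L L' : FirstOrder.Language.{u, u}} {P : Type u} [PartialOrder P]

/-- All algebras of the diagram belong to the variety `V`. -/
def AlgDiagram.IsIn (A : AlgDiagram L P) (V : Variety L) : Prop :=
  ∀ p, V.Mem (A.obj p)

/-- The diagram `B` lifts `Con_c ∘ A`: the diagrams `Con_c ∘ B` and `Con_c ∘ A` of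
`(∨, 0)`-semilattices are naturally isomorphic.  (An order isomorphism between
`(∨, 0)`-semilattices preserves joins and the least element.) -/
def AlgDiagram.LiftsConc (B : AlgDiagram L' P) (A : AlgDiagram L P) : Prop :=
  ∃ e : ∀ p, Conc L' (B.obj p) ≃o Conc L (A.obj p),
    ∀ (p q : P) (h : p ≤ q) (α : Conc L' (B.obj p)),
      e q (Conc.map (B.map h) α) = Conc.map (A.map h) (e p α)

end Diagrams

/-! ### Norm-coverings, lifters and condensates -/

/-- A finite subset `V` of a poset is a kernel if below each element of the poset there is a
largest element of `V`. -/
def IsKernel {X : Type u} [PartialOrder X] (V : Finset X) : Prop :=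
  ∀ x : X, ∃ v, IsGreatest {w | w ∈ V ∧ w ≤ x} v

/-- A norm-covering of `P`, with underlying poset `X`: the poset `X` is supported (each finite
subset is contained in a kernel) and `∂ : X → P` is isotone. -/
structure NormCovering (X P : Type u) [PartialOrder X] [PartialOrder P] where
  supported : ∀ F : Finset X, ∃ V : Finset X, F ⊆ V ∧ IsKernel V
  del : X →o P

namespace NormCovering

variable {X P : Type u} [PartialOrder X] [PartialOrder P] (N : NormCovering X P)

/-- The poset `Id_s X` of sharp ideals: ideals `x` (nonempty directed lower subsets) of `X` such
that `{∂u | u ∈ x}` has a largest element, ordered by inclusion. -/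
abbrev SharpIdeal : Type u :=
  {I : Order.Ideal X // ∃ p, IsGreatest (N.del '' (I : Set X)) p}

/-- The largest element `∂x` of `{∂u | u ∈ x}`, for a sharp ideal `x`. -/
noncomputable def norm (I : N.SharpIdeal) : P := I.2.choose

/-- The set of all members `x` of `𝐗` such that `∂x` is not maximal in `P`. -/
def nonMax (XX : Set N.SharpIdeal) : Set N.SharpIdeal := {I | I ∈ XX ∧ ¬ IsMax (N.norm I)}

theorem mem_nonMax {XX : Set N.SharpIdeal} (I : XX) {p q : P} (h : N.norm I = p) (hpq : p < q) :
    I.1 ∈ N.nonMax XX :=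
  ⟨I.2, by rw [h]; exact hpq.not_isMax⟩

/-- `(X, 𝐗)` is an `ℵ₀`-lifter of `P`. -/
structure IsLifter (XX : Set N.SharpIdeal) : Prop where
  lowerFinite : ∀ I ∈ N.nonMax XX, {J | J ∈ XX ∧ J ≤ I}.Finite
  exists_section : ∀ S : N.nonMax XX → Finset X,
    ∃ (σ : P →o XX) (hσ : ∀ p, N.norm (σ p) = p),
      ∀ (p q : P) (hpq : p < q), ∀ x ∈ S ⟨σ p, N.mem_nonMax (σ p) (hσ p) hpq⟩,
        x ∈ (σ q).1.1 → x ∈ (σ p).1.1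

end NormCovering

/-- The product of a family of algebras, with the operations defined componentwise. -/
instance piStructure {L : FirstOrder.Language.{u, u}} {ι : Type u} (M : ι → Type u)
    [∀ i, L.Structure (M i)] : L.Structure (∀ i, M i) where
  funMap f x := fun i => funMap f fun k => x k i
  RelMap r x := ∀ i, RelMap r fun k => x k i

section Condensate

variable {L : FirstOrder.Language.{u, u}} {X P : Type u} [PartialOrder X] [PartialOrder P]

/-- The family `a` is supported by `V`: whenever `v` is the largest element of `V` below `x`, the
entry `a x` is the image of the entry `a v` under the morphism `A_{∂v} → A_{∂x}`. -/
def SupportedBy (N : NormCovering X P) (A : AlgDiagram L P) (V : Finset X)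
    (a : ∀ x : X, A.obj (N.del x)) : Prop :=
  ∀ (x v : X) (hv : IsGreatest {w | w ∈ V ∧ w ≤ x} v),
    a x = A.map (N.del.monotone hv.1.2) (a v)

theorem SupportedBy.mono {N : NormCovering X P} {A : AlgDiagram L P} {V W : Finset X}
    {a : ∀ x : X, A.obj (N.del x)} (ha : SupportedBy N A V a) (hV : IsKernel V) (hVW : V ⊆ W) :
    SupportedBy N A W a := by
  intro x w hw
  obtain ⟨v, hv⟩ := hV x
  have hvw : IsGreatest {w' | w' ∈ V ∧ w' ≤ w} v :=
    ⟨⟨hv.1.1, hw.2 ⟨hVW hv.1.1, hv.1.2⟩⟩, fun v' hv' => hv.2 ⟨hv'.1, hv'.2.trans hw.1.2⟩⟩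
  rw [ha x v hv, ha w v hvw, A.map_comp]

/-- The condensate `F(X) ⊗ A`.  For a kernel `V` of `X`, the finite product
`∏_{v ∈ V} A_{∂v}` is identified with the algebra of all families in `∏_{x ∈ X} A_{∂x}` that are
supported by `V` (a family `(a_v)` in the finite product is extended to `X` by letting `a_x` be the
image of `a_v`, where `v` is the largest element of `V` below `x`).  For kernels `V ⊆ W` the
transition morphism `∏_{v ∈ V} A_{∂v} → ∏_{w ∈ W} A_{∂w}` becomes the inclusion, so that the
directed colimit of these finite products, over all kernels of `X`, is the union over all
kernels. -/
def condensate (N : NormCovering X P) (A : AlgDiagram L P) :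
    L.Substructure (∀ x : X, A.obj (N.del x)) where
  carrier := {a | ∃ V : Finset X, IsKernel V ∧ SupportedBy N A V a}
  fun_mem {n} f := by
    classical
    intro a ha
    choose V hV hVa using ha
    obtain ⟨W, hVW, hW⟩ := N.supported (Finset.univ.biUnion V)
    refine ⟨W, hW, fun x w hw => ?_⟩
    have h : ∀ i, a i x = A.map (N.del.monotone hw.1.2) (a i w) := fun i =>
      (hVa i).mono (hV i) ((Finset.subset_biUnion_of_mem V (Finset.mem_univ i)).trans hVW) x w hw
    change funMap f (fun k => a k x) = A.map _ (funMap f fun k => a k w)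
    rw [FirstOrder.Language.Hom.map_fun]
    congr 1
    funext i
    exact h i

end Condensate

end CondLift

open CondLift

/-! Each sharp ideal x gives a surjection π_x from the condensate onto A_{∂x}. Composing Con_c π_x
with the given isomorphism χ yields an ideal-induced map on Con_c B. Its kernel is an ideal of Con_c
B, hence a congruence θ_x of B, and Con_c(B/θ_x) ≅ Con_c A_{∂x}
(`IsIdealInduced.exists_orderIso_conc`).

For x ⊆ y the identity of B need not induce a map B/θ_x → B/θ_y: π_y agrees with the transition
morphism after π_x only on elements having a support V with V ∩ y ⊆ x (`exists_support_conc`). The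
lifter secures this for finitely many elements at a time, and that is enough. If ∂x is not maximal,
congruence-properness makes B/θ_x finite, so it has a finite set of representatives. Collect these
over the finitely many members of 𝐗 below x, apply each operation once, and let S(x) be the union of
the supports for all pairs of the resulting finite set. The section σ for this S allows the
transition maps to be defined on representatives (`exists_lifting`).

For the critical point, the condensate lies in the variety, and it and its Con_c have at most ℵ₀ +
card X elements. So Con_c of the condensate witnesses the bound. -/

namespace CondLift

open FirstOrder.Language

/-! ### Ideal-induced maps of semilattices -/

section IdealInduced

/-- A map `g` between `(∨, 0)`-semilattices is ideal-induced if it is, up to isomorphism, the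
canonical projection onto the quotient by an ideal. -/
structure IsIdealInduced {S T : Type u} [SemilatticeSup S] [OrderBot S] [PartialOrder T]
    [OrderBot T] (g : S → T) : Prop where
  surjective : Function.Surjective g
  le_iff : ∀ α β, g α ≤ g β ↔ ∃ κ, g κ = ⊥ ∧ α ≤ β ⊔ κ

namespace IsIdealInduced

variable {S T U : Type u} [SemilatticeSup S] [OrderBot S] [PartialOrder T] [OrderBot T]
  [PartialOrder U] [OrderBot U] {g : S → T}

theorem map_bot (hg : IsIdealInduced g) : g ⊥ = ⊥ := by
  obtain ⟨κ, hκ⟩ := hg.surjective ⊥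
  exact le_bot_iff.1 <| hκ ▸ (hg.le_iff ⊥ κ).2 ⟨κ, hκ, bot_le⟩

theorem monotone (hg : IsIdealInduced g) : Monotone g := fun α β h =>
  (hg.le_iff α β).2 ⟨⊥, hg.map_bot, le_sup_of_le_left h⟩

theorem sup_eq_bot (hg : IsIdealInduced g) {α β : S} (hα : g α = ⊥) (hβ : g β = ⊥) :
    g (α ⊔ β) = ⊥ :=
  le_bot_iff.1 <| hα ▸ (hg.le_iff _ α).2 ⟨β, hβ, le_rfl⟩

theorem eq_bot_of_le (hg : IsIdealInduced g) {α β : S} (h : α ≤ β) (hβ : g β = ⊥) : g α = ⊥ :=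
  le_bot_iff.1 <| hβ ▸ hg.monotone h

theorem comp_orderIso {R : Type u} [SemilatticeSup R] [OrderBot R] (hg : IsIdealInduced g)
    (χ : R ≃o S) : IsIdealInduced fun α => g (χ α) where
  surjective := hg.surjective.comp χ.surjective
  le_iff α β := by
    rw [hg.le_iff]
    constructor
    · rintro ⟨κ, hκ, h⟩
      refine ⟨χ.symm κ, by simpa using hκ, ?_⟩
      rw [← χ.le_iff_le, map_sup]
      simpa using h
    · rintro ⟨κ, hκ, h⟩
      exact ⟨χ κ, hκ, by rw [← map_sup]; exact χ.monotone h⟩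

/-- Two ideal-induced maps with the same kernel differ by an isomorphism. -/
theorem exists_orderIso {g' : S → U} (hg : IsIdealInduced g) (hg' : IsIdealInduced g')
    (h : ∀ α, g α = ⊥ ↔ g' α = ⊥) : ∃ e : T ≃o U, ∀ α, e (g α) = g' α := by
  -- The order on the image of an ideal-induced map depends only on its kernel.
  have hle : ∀ α β, g' α ≤ g' β ↔ g α ≤ g β := fun α β => by
    simp only [hg.le_iff, hg'.le_iff, h]
  choose s hs using hg.surjective
  have hs' : ∀ α, g' (s (g α)) = g' α := fun α =>
    le_antisymm ((hle _ _).2 (hs _).le) ((hle _ _).2 (hs _).ge)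
  let e : T ↪o U := OrderEmbedding.ofMapLEIff (fun t => g' (s t)) fun t t' => by
    rw [hle, hs, hs]
  refine ⟨RelIso.ofSurjective e fun u => ?_, hs'⟩
  obtain ⟨α, rfl⟩ := hg'.surjective u
  exact ⟨g α, hs' α⟩

end IsIdealInduced

end IdealInduced

/-! ### Compact congruences and surjective morphisms -/

section Congruences

variable {L : FirstOrder.Language.{u, u}} {A B C : Type u} [L.Structure A] [L.Structure B]
  [L.Structure C]

theorem Congr.principal_rel (a b : A) : (principal a b : Congr L A).rel a b :=
  principal_le.1 le_rfl

variable (L) in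
/-- The principal congruence `Θ_A(a, b)`, as a member of `Con_c A`. -/
def Conc.principal (a b : A) : Conc L A := ⟨Congr.principal a b, {(a, b)}, by simp⟩

theorem Conc.principal_le {a b : A} {β : Conc L A} : Conc.principal L a b ≤ β ↔ β.1.rel a b :=
  Congr.principal_le

theorem Conc.induction {p : Conc L A → Prop} (bot : p ⊥)
    (sup : ∀ α β, p α → p β → p (α ⊔ β)) (principal : ∀ a b, p (Conc.principal L a b))
    (α : Conc L A) : p α := by
  classical
  obtain ⟨_, s, rfl⟩ := α
  induction s using Finset.induction_on with
  | empty => exact bot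
  | insert z s _ ih =>
    have h := sup _ _ (principal z.1 z.2) (ih)
    convert h using 1
    exact Subtype.ext (Finset.sup_insert)

theorem Conc.map_principal (f : A →[L] B) (a b : A) :
    Conc.map f (Conc.principal L a b) = Conc.principal L (f a) (f b) :=
  Subtype.ext (Congr.map_principal f a b)

theorem Conc.map_bot (f : A →[L] B) : Conc.map f (⊥ : Conc L A) = ⊥ :=
  Subtype.ext (Congr.gc_map_comap f).l_bot

theorem Conc.map_sup (f : A →[L] B) (α β : Conc L A) :
    Conc.map f (α ⊔ β) = Conc.map f α ⊔ Conc.map f β :=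
  Subtype.ext (Congr.gc_map_comap f).l_sup

theorem Conc.map_eq_self {f : A →[L] A} (hf : ∀ a, f a = a) (α : Conc L A) :
    Conc.map f α = α := by
  induction α using Conc.induction with
  | bot => exact Conc.map_bot f
  | sup α β hα hβ => rw [Conc.map_sup, hα, hβ]
  | principal a b => rw [Conc.map_principal, hf, hf]

/-- Here `Congr.comap f ⊥` is the kernel of `f`, so the kernel of Con_c f is the ideal of compact
congruences below ker f. -/
theorem Conc.map_eq_bot_iff {f : A →[L] B} {α : Conc L A} :
    Conc.map f α = ⊥ ↔ α.1 ≤ Congr.comap f ⊥ := by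
  rw [← Congr.gc_map_comap f, le_bot_iff, Subtype.ext_iff]
  rfl

theorem Congr.bot_rel {a b : A} : (⊥ : Congr L A).rel a b ↔ a = b := by
  refine ⟨fun h => ?_, fun h => h ▸ (⊥ : Congr L A).equiv.refl a⟩
  let δ : Congr L A :=
    { rel := Eq
      equiv := eq_equivalence
      compat := fun f x y h => congrArg _ (funext h) }
  exact (bot_le : ⊥ ≤ δ) a b h

/-- Finitely generated congruences are compact. -/
theorem Conc.exists_le_sup {α β : Conc L A} {θ : Congr L A} (h : α.1 ≤ β.1 ⊔ θ) :
    ∃ κ : Conc L A, κ.1 ≤ θ ∧ α ≤ β ⊔ κ := by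
  -- The union of the congruences β ∨ κ over finitely generated κ ≤ θ. This union is directed, and
  -- operations have finite arity, so it is a congruence.
  let ψ : Congr L A :=
    { rel := fun x y => ∃ κ : Conc L A, κ.1 ≤ θ ∧ (β ⊔ κ).1.rel x y
      equiv :=
        ⟨fun x => ⟨⊥, bot_le, Congr.equiv _ |>.refl x⟩,
          fun ⟨κ, hκ, h⟩ => ⟨κ, hκ, Congr.equiv _ |>.symm h⟩,
          fun {x y z} ⟨κ, hκ, h⟩ ⟨κ', hκ', h'⟩ => by
            refine ⟨κ ⊔ κ', sup_le hκ hκ', Congr.equiv _ |>.trans (y := y) ?_ ?_⟩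
            · exact (sup_le_sup_left le_sup_left β : β ⊔ κ ≤ β ⊔ (κ ⊔ κ')) _ _ h
            · exact (sup_le_sup_left le_sup_right β : β ⊔ κ' ≤ β ⊔ (κ ⊔ κ')) _ _ h'⟩
      compat := fun {n} f x y h => by
        choose κ hκ h using h
        refine ⟨Finset.univ.sup κ, ?_, Congr.compat _ f x y fun i => ?_⟩
        · exact Finset.sup_induction (p := fun κ : Conc L A => κ.1 ≤ θ) bot_le
            (fun _ ha _ hb => sup_le ha hb) fun i _ => hκ i
        · have h' : β ⊔ κ i ≤ β ⊔ Finset.univ.sup κ :=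
            sup_le_sup_left (Finset.le_sup (Finset.mem_univ i)) β
          exact h' _ _ (h i) }
  have hψ : β.1 ⊔ θ ≤ ψ := by
    refine sup_le (fun x y hxy => ⟨⊥, bot_le, ?_⟩) fun x y hxy =>
      ⟨Conc.principal L x y, Congr.principal_le.2 hxy, ?_⟩
    · exact (le_sup_left : β ≤ β ⊔ ⊥) _ _ hxy
    · exact (le_sup_right : _ ≤ β ⊔ Conc.principal L x y) _ _ (Congr.principal_rel x y)
  have key : ∀ x y, (β.1 ⊔ θ).rel x y → ∃ κ : Conc L A, κ.1 ≤ θ ∧ (β ⊔ κ).1.rel x y := hψ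
  induction α using Conc.induction with
  | bot => exact ⟨⊥, bot_le, bot_le⟩
  | sup α α' hα hα' =>
    obtain ⟨κ, hκ, h₁⟩ := hα (le_sup_left.trans h)
    obtain ⟨κ', hκ', h₂⟩ := hα' (le_sup_right.trans h)
    exact ⟨κ ⊔ κ', sup_le hκ hκ', sup_le (h₁.trans (sup_le_sup_left le_sup_left β))
      (h₂.trans (sup_le_sup_left le_sup_right β))⟩
  | principal a b =>
    obtain ⟨κ, hκ, hab⟩ := key a b (Congr.principal_le.1 h)
    exact ⟨κ, hκ, Conc.principal_le.2 hab⟩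

/-- For a surjective morphism, pulling back the image of a congruence joins it with the kernel. -/
theorem Congr.comap_map_le {f : A →[L] B} (hf : Function.Surjective f) (β : Congr L A) :
    comap f (map f β) ≤ β ⊔ comap f ⊥ := by
  set γ := β ⊔ comap f ⊥
  have hγ : ∀ {a a' : A}, f a = f a' → γ.rel a a' := fun h =>
    (le_sup_right : comap f ⊥ ≤ γ) _ _ (Congr.bot_rel.2 h)
  -- The direct image of γ is already transitive: since γ contains ker f, two preimages of one point
  -- are γ-related.
  let δ : Congr L B :=
    { rel := fun x y => ∃ a b, γ.rel a b ∧ f a = x ∧ f b = y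
      equiv :=
        ⟨fun x => (hf x).elim fun a ha => ⟨a, a, γ.equiv.refl a, ha, ha⟩,
          fun ⟨a, b, h, ha, hb⟩ => ⟨b, a, γ.equiv.symm h, hb, ha⟩,
          fun ⟨a, b, h, ha, hb⟩ ⟨c, d, h', hc, hd⟩ => ⟨a, d,
            γ.equiv.trans h (γ.equiv.trans (hγ (hb.trans hc.symm)) h'), ha, hd⟩⟩
      compat := fun g x y h => by
        choose a b h ha hb using h
        refine ⟨funMap g a, funMap g b, γ.compat g a b h, ?_, ?_⟩
        · rw [f.map_fun]
          exact congrArg _ (funext ha)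
        · rw [f.map_fun]
          exact congrArg _ (funext hb) }
  have hδ : map f β ≤ δ := by
    rw [map, gen_le]
    rintro _ _ ⟨a, b, h, rfl, rfl⟩
    exact ⟨a, b, (le_sup_left : β ≤ γ) _ _ h, rfl, rfl⟩
  intro x y h
  obtain ⟨a, b, h, ha, hb⟩ := hδ _ _ h
  exact γ.equiv.trans (hγ ha.symm) (γ.equiv.trans h (hγ hb))

/-- The image of α lies below that of β exactly when α ≤ β ∨ ker f. Compactness of α then replaces
ker f by a finitely generated congruence below it. -/
theorem Conc.isIdealInduced_map {f : A →[L] B} (hf : Function.Surjective f) :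
    IsIdealInduced (Conc.map f) where
  surjective β := by
    induction β using Conc.induction with
    | bot => exact ⟨⊥, Conc.map_bot f⟩
    | sup α β hα hβ =>
      obtain ⟨α, rfl⟩ := hα
      obtain ⟨β, rfl⟩ := hβ
      exact ⟨α ⊔ β, Conc.map_sup f α β⟩
    | principal a b =>
      obtain ⟨a, rfl⟩ := hf a
      obtain ⟨b, rfl⟩ := hf b
      exact ⟨_, Conc.map_principal f a b⟩
  le_iff α β := by
    constructor
    · intro h
      have h' : α.1 ≤ β.1 ⊔ Congr.comap f ⊥ :=
        (((Congr.gc_map_comap f) _ _).1 h).trans (Congr.comap_map_le hf β.1)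
      obtain ⟨κ, hκ, h⟩ := Conc.exists_le_sup h'
      exact ⟨κ, Conc.map_eq_bot_iff.2 hκ, h⟩
    · rintro ⟨κ, hκ, h⟩
      have := (Congr.gc_map_comap f).monotone_l h
      change Conc.map f α ≤ Conc.map f (β ⊔ κ) at this
      rwa [Conc.map_sup, hκ, sup_bot_eq] at this

/-- A congruence is determined by the principal congruences below it. -/
theorem finite_congr [Finite (Conc L A)] : Finite (Congr L A) := by
  refine Finite.of_injective (fun α : Congr L A => {κ : Conc L A | κ.1 ≤ α}) fun α β h => ?_
  have key : ∀ x y, Conc.principal L x y ∈ {κ : Conc L A | κ.1 ≤ α} ↔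
      Conc.principal L x y ∈ {κ : Conc L A | κ.1 ≤ β} := fun x y => by
    simp only at h
    rw [h]
  ext x y
  have := key x y
  rwa [Set.mem_ofPred_eq, Set.mem_ofPred_eq, Conc.principal, Congr.principal_le,
    Congr.principal_le] at this

end Congruences

/-! ### Quotients by ideals of compact congruences -/

section Quotients

variable {L : FirstOrder.Language.{u, u}} {B : Type u} [L.Structure B]

namespace Congr

/-- The underlying set of the quotient of an algebra by a congruence. -/
def Quot (θ : Congr L B) : Type u := Quotient (⟨θ.rel, θ.equiv⟩ : Setoid B)

/-- The class of an element modulo a congruence. -/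
def cls (θ : Congr L B) (b : B) : θ.Quot := Quotient.mk (⟨θ.rel, θ.equiv⟩ : Setoid B) b

theorem cls_surjective (θ : Congr L B) : Function.Surjective θ.cls := Quotient.mk_surjective

theorem cls_eq {θ : Congr L B} {a b : B} : θ.cls a = θ.cls b ↔ θ.rel a b := Quotient.eq

noncomputable instance (θ : Congr L B) : L.Structure θ.Quot where
  funMap f x := θ.cls (funMap f fun i => Function.surjInv θ.cls_surjective (x i))
  RelMap r x := ∃ y, RelMap r y ∧ (fun i => θ.cls (y i)) = x

/-- The canonical projection onto the quotient by a congruence. -/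
def proj (θ : Congr L B) : B →[L] θ.Quot where
  toFun := θ.cls
  map_fun' f _ := cls_eq.2 <| θ.compat f _ _ fun _ =>
    cls_eq.1 (Function.surjInv_eq θ.cls_surjective _).symm
  map_rel' _ x h := ⟨x, h, rfl⟩

theorem proj_surjective (θ : Congr L B) : Function.Surjective θ.proj := θ.cls_surjective

theorem proj_eq {θ : Congr L B} {a b : B} : θ.proj a = θ.proj b ↔ θ.rel a b := cls_eq

theorem comap_proj_bot (θ : Congr L B) : comap θ.proj ⊥ = θ := by
  ext a b
  exact bot_rel.trans proj_eq

end Congr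

theorem Variety.Mem.of_surjective {V : Variety L} {A : Type u} [L.Structure A] (hB : V.Mem B)
    {f : B →[L] A} (hf : Function.Surjective f) : V.Mem A := by
  refine ⟨hB.1.map f, fun e he v => ?_⟩
  obtain ⟨w, rfl⟩ : ∃ w : ℕ → B, f ∘ w = v :=
    ⟨fun n => (hf (v n)).choose, funext fun n => (hf (v n)).choose_spec⟩
  rw [HomClass.realize_term, HomClass.realize_term, hB.2 e he w]

/-- The congruence associated with the kernel of an ideal-induced map on `Con_c B`. -/
def IsIdealInduced.congr {T : Type u} [PartialOrder T] [OrderBot T] {g : Conc L B → T}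
    (hg : IsIdealInduced g) : Congr L B where
  rel a b := g (Conc.principal L a b) = ⊥
  equiv :=
    ⟨fun a => hg.eq_bot_of_le (Conc.principal_le.2 (Congr.equiv _ |>.refl a)) hg.map_bot,
      fun h => hg.eq_bot_of_le
        (Conc.principal_le.2 (Congr.equiv _ |>.symm (Congr.principal_rel _ _))) h,
      fun {a b c} h h' => hg.eq_bot_of_le (Conc.principal_le.2 <|
        Congr.equiv (Conc.principal L a b ⊔ Conc.principal L b c).1 |>.trans
          ((le_sup_left : Conc.principal L a b ≤ Conc.principal L a b ⊔ Conc.principal L b c)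
            _ _ (Congr.principal_rel _ _))
          ((le_sup_right : Conc.principal L b c ≤ Conc.principal L a b ⊔ Conc.principal L b c)
            _ _ (Congr.principal_rel _ _))) (hg.sup_eq_bot h h')⟩
  compat f x y h := by
    refine hg.eq_bot_of_le (β := Finset.univ.sup fun i => Conc.principal L (x i) (y i))
      (Conc.principal_le.2 (Congr.compat _ f x y fun i => ?_)) ?_
    · exact Conc.principal_le.1
        (Finset.le_sup (f := fun i => Conc.principal L (x i) (y i)) (Finset.mem_univ i))
    · exact Finset.sup_induction (p := fun κ : Conc L B => g κ = ⊥) hg.map_bot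
        (fun _ ha _ hb => hg.sup_eq_bot ha hb) fun i _ => h i

theorem IsIdealInduced.congr_rel {T : Type u} [PartialOrder T] [OrderBot T] {g : Conc L B → T}
    (hg : IsIdealInduced g) {a b : B} : hg.congr.rel a b ↔ g (Conc.principal L a b) = ⊥ := Iff.rfl

/-- No information is lost in passing from the ideal to the congruence: the ideal is recovered as
the compact congruences below it. -/
theorem IsIdealInduced.le_congr_iff {T : Type u} [PartialOrder T] [OrderBot T] {g : Conc L B → T}
    (hg : IsIdealInduced g) (κ : Conc L B) : κ.1 ≤ hg.congr ↔ g κ = ⊥ := by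
  constructor
  · intro h
    induction κ using Conc.induction with
    | bot => exact hg.map_bot
    | sup α β hα hβ =>
      exact hg.sup_eq_bot (hα (le_sup_left.trans h)) (hβ (le_sup_right.trans h))
    | principal a b => exact Congr.principal_le.1 h
  · intro h x y hxy
    exact hg.eq_bot_of_le (Conc.principal_le.2 hxy) h

/-- The semilattice `Con_c (B / θ)`, where `θ` is given by the kernel of an ideal-induced map `g`
on `Con_c B`, is isomorphic to the range of `g`. -/
theorem IsIdealInduced.exists_orderIso_conc {T : Type u} [PartialOrder T] [OrderBot T]
    {g : Conc L B → T} (hg : IsIdealInduced g) :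
    ∃ e : Conc L hg.congr.Quot ≃o T, ∀ α, e (Conc.map hg.congr.proj α) = g α := by
  refine (Conc.isIdealInduced_map hg.congr.proj_surjective).exists_orderIso hg fun α => ?_
  rw [Conc.map_eq_bot_iff, Congr.comap_proj_bot, hg.le_congr_iff]

end Quotients

/-! ### Projections of the condensate at sharp ideals -/

section Condensate

variable {L : FirstOrder.Language.{u, u}} {X P : Type u} [PartialOrder X] [PartialOrder P]
  {N : NormCovering X P} {A : AlgDiagram L P}

theorem NormCovering.isGreatest_norm (I : N.SharpIdeal) :
    IsGreatest (N.del '' (I.1 : Set X)) (N.norm I) := I.2.choose_spec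

/-- As `I` is directed, some u in `I` bounds the finite set V ∩ I, and V · u is its largest element.
-/
theorem IsKernel.exists_isGreatest_ideal {V : Finset X} (hV : IsKernel V) (I : Order.Ideal X) :
    ∃ v, IsGreatest {w | w ∈ V ∧ w ∈ I} v := by
  classical
  obtain ⟨u, hu, hVu⟩ : ∃ u ∈ I, ∀ w ∈ V, w ∈ I → w ≤ u := by
    clear hV
    induction V using Finset.induction_on with
    | empty => exact I.nonempty.imp fun u hu => ⟨hu, by simp⟩
    | insert z V _ ih =>
      obtain ⟨u, hu, h⟩ := ih
      by_cases hz : z ∈ I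
      · obtain ⟨t, ht, hut, hzt⟩ := I.directed u hu z hz
        refine ⟨t, ht, fun w hw hwI => ?_⟩
        rcases Finset.mem_insert.1 hw with rfl | hw
        · exact hzt
        · exact (h w hw hwI).trans hut
      · refine ⟨u, hu, fun w hw hwI => ?_⟩
        rcases Finset.mem_insert.1 hw with rfl | hw
        · exact absurd hwI hz
        · exact h w hw hwI
  obtain ⟨v, hv⟩ := hV u
  exact ⟨v, ⟨hv.1.1, I.lower hv.1.2 hu⟩, fun w hw => hv.2 ⟨hw.1, hVu w hw.1 hw.2⟩⟩

theorem isGreatest_le_of_ideal {V : Finset X} {I : Order.Ideal X} {v u : X}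
    (hv : IsGreatest {w | w ∈ V ∧ w ∈ I} v) (hu : u ∈ I) (hvu : v ≤ u) :
    IsGreatest {w | w ∈ V ∧ w ≤ u} v :=
  ⟨⟨hv.1.1, hvu⟩, fun _ hw => hv.2 ⟨hw.1, I.lower hw.2 hu⟩⟩

theorem del_le {I : Order.Ideal X} {p : P} (hp : IsGreatest (N.del '' (I : Set X)) p) {v : X}
    (hv : v ∈ I) : N.del v ≤ p := hp.2 ⟨v, hv, rfl⟩

/-- Both sides are the image of the entry at a common upper bound of `v` and `w` in `I`. Hence the
projection does not depend on the chosen support. -/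
theorem SupportedBy.map_eq {V W : Finset X} {a : ∀ x : X, A.obj (N.del x)}
    (hV : SupportedBy N A V a) (hW : SupportedBy N A W a) {I : Order.Ideal X} {p : P}
    (hp : IsGreatest (N.del '' (I : Set X)) p) {v w : X}
    (hv : IsGreatest {w | w ∈ V ∧ w ∈ I} v) (hw : IsGreatest {v | v ∈ W ∧ v ∈ I} w) :
    A.map (del_le hp hv.1.2) (a v) = A.map (del_le hp hw.1.2) (a w) := by
  obtain ⟨u, hu, hvu, hwu⟩ := I.directed v hv.1.2 w hw.1.2
  have h₁ := hV u v (isGreatest_le_of_ideal hv hu hvu)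
  have h₂ := hW u w (isGreatest_le_of_ideal hw hu hwu)
  rw [← A.map_comp (N.del.monotone hvu) (del_le hp hu), ← h₁, h₂, A.map_comp]

theorem exists_value (I : Order.Ideal X) {p : P} (hp : IsGreatest (N.del '' (I : Set X)) p)
    (a : condensate N A) :
    ∃ c : A.obj p, ∀ V : Finset X, SupportedBy N A V a.1 →
      ∀ (v : X) (hv : IsGreatest {w | w ∈ V ∧ w ∈ I} v), A.map (del_le hp hv.1.2) (a.1 v) = c := by
  obtain ⟨W, hW, hWa⟩ := a.2
  obtain ⟨w, hw⟩ := hW.exists_isGreatest_ideal I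
  exact ⟨A.map (del_le hp hw.1.2) (a.1 w), fun V hVa v hv => hVa.map_eq hWa hp hv hw⟩

/-- A family indexed by a kernel extends to an element of the condensate. -/
theorem exists_extension {V : Finset X} (hV : IsKernel V) (c : ∀ x : X, A.obj (N.del x)) :
    ∃ a : condensate N A, SupportedBy N A V a.1 ∧ ∀ v ∈ V, a.1 v = c v := by
  choose k hk using hV
  let a : ∀ x : X, A.obj (N.del x) := fun x => A.map (N.del.monotone (hk x).1.2) (c (k x))
  have ha : ∀ (x v : X) (hv : IsGreatest {w | w ∈ V ∧ w ≤ x} v),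
      a x = A.map (N.del.monotone hv.1.2) (c v) := fun x v hv => by
    obtain rfl := hv.unique (hk x)
    rfl
  have hav : ∀ v ∈ V, a v = c v := fun v hv => by
    rw [ha v v ⟨⟨hv, le_rfl⟩, fun w hw => hw.2⟩, A.map_id]
  have hs : SupportedBy N A V a := fun x v hv => by rw [ha x v hv, hav v hv.1.1]
  exact ⟨⟨a, V, fun x => ⟨k x, hk x⟩, hs⟩, hs, hav⟩

variable [L.IsAlgebraic]

/-- The canonical projection of the condensate onto the algebra of the diagram indexed by `∂x`, for
a sharp ideal `x`. -/
noncomputable def condensateProj (A : AlgDiagram L P) (I : Order.Ideal X) {p : P}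
    (hp : IsGreatest (N.del '' (I : Set X)) p) : condensate N A →[L] A.obj p where
  toFun a := (exists_value I hp a).choose
  map_fun' {n} f a := by
    classical
    choose V hV hVa using fun i => (a i).2
    obtain ⟨W, hVW, hW⟩ := N.supported (Finset.univ.biUnion V)
    have hWa : ∀ i, SupportedBy N A W (a i).1 := fun i => (hVa i).mono (hV i)
      ((Finset.subset_biUnion_of_mem V (Finset.mem_univ i)).trans hVW)
    have hWf : SupportedBy N A W (funMap f a : condensate N A).1 := fun x w hw => by
      change funMap f (fun k => (a k).1 x) = A.map _ (funMap f fun k => (a k).1 w)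
      rw [FirstOrder.Language.Hom.map_fun]
      exact congrArg _ (funext fun i => hWa i x w hw)
    obtain ⟨w, hw⟩ := hW.exists_isGreatest_ideal I
    rw [← (exists_value I hp (funMap f a)).choose_spec W hWf w hw]
    change A.map _ (funMap f fun k => (a k).1 w) = _
    rw [FirstOrder.Language.Hom.map_fun]
    exact congrArg _ (funext fun i => (exists_value I hp (a i)).choose_spec W (hWa i) w hw)
  map_rel' r := isEmptyElim r

theorem condensateProj_eq {I : Order.Ideal X} {p : P} (hp : IsGreatest (N.del '' (I : Set X)) p)
    {a : condensate N A} {V : Finset X} (hV : SupportedBy N A V a.1) {v : X}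
    (hv : IsGreatest {w | w ∈ V ∧ w ∈ I} v) :
    condensateProj A I hp a = A.map (del_le hp hv.1.2) (a.1 v) :=
  ((exists_value I hp a).choose_spec V hV v hv).symm

theorem condensateProj_surjective (hA : ∀ p, Nonempty (A.obj p)) {I : Order.Ideal X} {p : P}
    (hp : IsGreatest (N.del '' (I : Set X)) p) :
    Function.Surjective (condensateProj A I hp) := by
  classical
  intro c
  obtain ⟨u, hu, hup⟩ := hp.1
  obtain ⟨V, hVu, hV⟩ := N.supported {u}
  obtain ⟨v, hv⟩ := hV.exists_isGreatest_ideal I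
  -- The kernel contains a point of `I` of norm p, so its largest element in `I` also has norm p,
  -- and the entry there can be prescribed freely.
  obtain rfl : N.del v = p := le_antisymm (del_le hp hv.1.2) <|
    hup ▸ N.del.monotone (hv.2 ⟨hVu (Finset.mem_singleton_self u), hu⟩)
  obtain ⟨a, ha, hav⟩ := exists_extension (A := A) hV
    (Function.update (fun x => (hA (N.del x)).some) v c)
  refine ⟨a, ?_⟩
  rw [condensateProj_eq hp ha hv, A.map_id, hav v hv.1.1, Function.update_self]

/-- Compatibility of the canonical projections, for elements with a support that has no point
in `J` outside `I`. -/
theorem exists_support (a : condensate N A) :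
    ∃ V : Finset X, ∀ (I J : Order.Ideal X) (p q : P) (hp : IsGreatest (N.del '' (I : Set X)) p)
      (hq : IsGreatest (N.del '' (J : Set X)) q) (hpq : p ≤ q), I ≤ J →
      (∀ x ∈ V, x ∈ J → x ∈ I) →
        condensateProj A J hq a = A.map hpq (condensateProj A I hp a) := by
  obtain ⟨V, hV, hVa⟩ := a.2
  refine ⟨V, fun I J p q hp hq hpq hIJ h => ?_⟩
  obtain ⟨v, hv⟩ := hV.exists_isGreatest_ideal J
  have hv' : IsGreatest {w | w ∈ V ∧ w ∈ I} v :=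
    ⟨⟨hv.1.1, h v hv.1.1 hv.1.2⟩, fun w hw => hv.2 ⟨hw.1, hIJ hw.2⟩⟩
  rw [condensateProj_eq hq hVa hv, condensateProj_eq hp hVa hv', A.map_comp]

/-- A compact congruence involves finitely many generating pairs, so the union of their supports
works. One finite set serves all pairs of ideals, which is the form the lifter needs. -/
theorem exists_support_conc (γ : Conc L (condensate N A)) :
    ∃ V : Finset X, ∀ (I J : Order.Ideal X) (p q : P) (hp : IsGreatest (N.del '' (I : Set X)) p)
      (hq : IsGreatest (N.del '' (J : Set X)) q) (hpq : p ≤ q), I ≤ J →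
      (∀ x ∈ V, x ∈ J → x ∈ I) →
        Conc.map (condensateProj A J hq) γ =
          Conc.map (A.map hpq) (Conc.map (condensateProj A I hp) γ) := by
  classical
  induction γ using Conc.induction with
  | bot => exact ⟨∅, fun I J p q hp hq hpq _ _ => by simp only [Conc.map_bot]⟩
  | sup α β hα hβ =>
    obtain ⟨V, hV⟩ := hα
    obtain ⟨W, hW⟩ := hβ
    refine ⟨V ∪ W, fun I J p q hp hq hpq hIJ h => ?_⟩
    rw [Conc.map_sup, Conc.map_sup, Conc.map_sup,
      hV I J p q hp hq hpq hIJ fun x hx => h x (Finset.mem_union_left _ hx),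
      hW I J p q hp hq hpq hIJ fun x hx => h x (Finset.mem_union_right _ hx)]
  | principal a b =>
    obtain ⟨V, hV⟩ := exists_support a
    obtain ⟨W, hW⟩ := exists_support b
    refine ⟨V ∪ W, fun I J p q hp hq hpq hIJ h => ?_⟩
    rw [Conc.map_principal, Conc.map_principal, Conc.map_principal,
      hV I J p q hp hq hpq hIJ fun x hx => h x (Finset.mem_union_left _ hx),
      hW I J p q hp hq hpq hIJ fun x hx => h x (Finset.mem_union_right _ hx)]

end Condensate

/-! ### Membership in the variety and cardinality bounds -/

section Membership

variable {L : FirstOrder.Language.{u, u}} {X P : Type u} [PartialOrder X] [PartialOrder P]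

theorem realize_pi {ι : Type u} (M : ι → Type u) [∀ i, L.Structure (M i)] (t : L.Term ℕ)
    (v : ℕ → ∀ i, M i) (i : ι) : t.realize v i = t.realize fun n => v n i := by
  induction t with
  | var n => rfl
  | func f ts ih =>
    change funMap f (fun k => (ts k).realize v i) = funMap f _
    exact congrArg _ (funext ih)

theorem condensate_mem {V : Variety L} {A : AlgDiagram L P} (hA : A.IsIn V)
    (N : NormCovering X P) : V.Mem (condensate N A) := by
  obtain ⟨K, -, hK⟩ := N.supported ∅
  obtain ⟨a, -⟩ := exists_extension (A := A) hK fun x => (hA (N.del x)).1.some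
  refine ⟨⟨a⟩, fun e he v => Subtype.ext <| funext fun x => ?_⟩
  have h : ∀ t : L.Term ℕ, (t.realize v : condensate N A).1 x =
      t.realize fun n => (v n).1 x := fun t => by
    rw [← realize_pi (fun x => A.obj (N.del x)) t (fun n => (v n).1) x]
    exact congrFun (HomClass.realize_term (condensate N A).subtype (t := t) (v := v)).symm x
  rw [h, h]
  exact (hA (N.del x)).2 e he _

open Cardinal in
theorem mk_finset_le (α : Type u) : #(Finset α) ≤ ℵ₀ + #α := by
  cases finite_or_infinite α
  · exact (Cardinal.lt_aleph0_of_finite _).le.trans (self_le_add_right _ _)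
  · rw [Cardinal.mk_finset_of_infinite]
    exact self_le_add_left _ _

open Cardinal in
-- An element is determined by a supporting kernel and its values there, and each kernel allows only
-- finitely many tuples of values.
theorem mk_condensate_le (N : NormCovering X P) (A : AlgDiagram L P)
    (hA : ∀ p, Finite (A.obj p)) : #(condensate N A) ≤ ℵ₀ + #X := by
  let κ := ℵ₀ + #X
  have hκ : ℵ₀ ≤ κ := self_le_add_right _ _
  choose K hK hKa using fun a : condensate N A => a.2
  have hinj : Function.Injective fun a : condensate N A =>
      (⟨K a, fun v => a.1 v.1⟩ : Σ V : Finset X, ∀ v : V, A.obj (N.del v.1)) := by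
    intro a b hab
    refine Subtype.ext (funext fun x => ?_)
    obtain ⟨v, hv⟩ := hK a x
    have h : ∀ V : Finset X, ∀ hvV : v ∈ V, ∀ c : ∀ v : V, A.obj (N.del v.1),
        (⟨K a, fun v => a.1 v.1⟩ : Σ V : Finset X, ∀ v : V, A.obj (N.del v.1)) = ⟨V, c⟩ →
          a.1 v = c ⟨v, hvV⟩ := by
      rintro V hvV c h
      cases h
      rfl
    have hKab : K a = K b := congrArg Sigma.fst hab
    have hb := hKa b x v (hKab ▸ hv)
    rw [hKa a x v hv, hb, h (K b) (hKab ▸ hv.1.1) _ hab]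
  refine (mk_le_of_injective hinj).trans ?_
  rw [mk_sigma]
  refine (sum_le_sum _ (fun _ => ℵ₀) fun V => (Cardinal.lt_aleph0_of_finite _).le).trans ?_
  rw [sum_const']
  exact mul_le_of_le hκ (mk_finset_le X) hκ

open Cardinal in
theorem mk_conc_le (A : Type u) [L.Structure A] : #(Conc L A) ≤ ℵ₀ + #A := by
  have h : Function.Surjective fun s : Finset (A × A) =>
      (⟨s.sup fun z => Congr.principal z.1 z.2, s, rfl⟩ : Conc L A) := by
    rintro ⟨_, s, rfl⟩
    exact ⟨s, rfl⟩
  refine (mk_le_of_surjective h).trans ((mk_finset_le _).trans ?_)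
  have hκ : ℵ₀ ≤ ℵ₀ + #A := self_le_add_right _ _
  refine add_le_of_le hκ hκ ?_
  rw [mk_prod, lift_id]
  exact mul_le_of_le hκ (self_le_add_left _ _) (self_le_add_left _ _)

end Membership

/-! ### Construction of the lifting -/

section Lifting

variable {LV LW : FirstOrder.Language.{u, u}} [LV.IsAlgebraic]

/-- For an isomorphism `χ : Con_c B → Con_c (F(X) ⊗ A)`, the ideal-induced map from `Con_c B` to
`Con_c A_{∂x}`, for a sharp ideal `x`. -/
theorem isIdealInduced_condensateProj {X P : Type u} [PartialOrder X] [PartialOrder P]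
    {N : NormCovering X P} {A : AlgDiagram LV P} (hA : ∀ p, Nonempty (A.obj p)) {B : Type u}
    [LW.Structure B] (χ : Conc LW B ≃o Conc LV (condensate N A)) {I : Order.Ideal X} {p : P}
    (hp : IsGreatest (N.del '' (I : Set X)) p) :
    IsIdealInduced fun α => Conc.map (condensateProj A I hp) (χ α) :=
  (Conc.isIdealInduced_map (condensateProj_surjective hA hp)).comp_orderIso χ

/-- A condensate in the range of `Con_c` on a congruence-proper variety of finite similarity type
gives a lifting of the diagram, by quotients of the given algebra. -/
theorem exists_lifting [LW.IsAlgebraic] {W : Variety LW} (hfin : Finite (Σ n, LW.Functions n))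
    (hW : W.CongruenceProper) {X P : Type u} [PartialOrder X] [PartialOrder P]
    {N : NormCovering X P} {XX : Set N.SharpIdeal} (hX : N.IsLifter XX)
    {A : AlgDiagram LV P} (hA : ∀ p, Nonempty (A.obj p))
    (hAfin : ∀ p : P, ¬ IsMax p → Finite (Conc LV (A.obj p)))
    {B : Type u} [LW.Structure B] (hB : W.Mem B)
    (χ : Conc LW B ≃o Conc LV (condensate N A)) :
    ∃ D : AlgDiagram LW P, D.IsIn W ∧ D.LiftsConc A ∧
      ∀ p, ∃ g : B →[LW] D.obj p, Function.Surjective g := by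
  classical
  have hg := fun (I : Order.Ideal X) (p : P) (hp : IsGreatest (N.del '' (I : Set X)) p) =>
    isIdealInduced_condensateProj hA χ hp
  -- finite sets of representatives modulo the congruences given by the members of `𝐗^=`
  have hF : ∀ I : N.nonMax XX, ∃ F : Finset B, ∀ (p : P)
      (hp : IsGreatest (N.del '' (I.1.1 : Set X)) p) (d : (hg I.1.1 p hp).congr.Quot),
        ∃ b ∈ F, (hg I.1.1 p hp).congr.proj b = d := by
    intro I
    have hI := N.isGreatest_norm I.1
    let θ := (hg I.1.1 _ hI).congr
    have : Finite (Conc LV (A.obj (N.norm I.1))) := hAfin _ I.2.2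
    obtain ⟨e, -⟩ := (hg I.1.1 _ hI).exists_orderIso_conc
    have : Finite (Conc LW θ.Quot) := Finite.of_equiv _ e.symm.toEquiv
    have : Finite θ.Quot := hW _ (hB.of_surjective θ.proj_surjective) finite_congr
    have := Fintype.ofFinite θ.Quot
    refine ⟨Finset.univ.image (Function.surjInv θ.proj_surjective), fun p hp d => ?_⟩
    obtain rfl := hp.unique hI
    exact ⟨_, Finset.mem_image_of_mem _ (Finset.mem_univ d),
      Function.surjInv_eq θ.proj_surjective d⟩
  choose F hF using hF
  -- Including the representatives from all smaller ideals is what will make the transition maps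
  -- compose.
  have hG : ∀ I : N.nonMax XX, ∃ G : Finset B, ∀ J : N.nonMax XX, J.1 ≤ I.1 → F J ⊆ G := by
    intro I
    have hfinI : {J : N.nonMax XX | J.1 ≤ I.1}.Finite :=
      Set.Finite.of_finite_image ((hX.lowerFinite I.1 I.2).subset (by
        rintro _ ⟨J, hJ, rfl⟩
        exact ⟨J.2.1, hJ⟩)) Subtype.val_injective.injOn
    exact ⟨hfinI.toFinset.biUnion F, fun J hJ =>
      Finset.subset_biUnion_of_mem F (hfinI.mem_toFinset.2 hJ)⟩
  choose G hG using hG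
  -- One application of each operation suffices for the transition maps to be morphisms; the result
  -- is finite because the similarity type is.
  have hT : ∀ I : N.nonMax XX, ∃ T : Finset B, G I ⊆ T ∧ ∀ (n : ℕ) (f : LW.Functions n)
      (x : Fin n → B), (∀ i, x i ∈ G I) → funMap f x ∈ T := by
    intro I
    have hfinT : (Set.range fun z : Σ f : Σ n, LW.Functions n, Fin f.1 → G I =>
        funMap z.1.2 fun i => (z.2 i : B)).Finite := Set.finite_range _
    refine ⟨G I ∪ hfinT.toFinset, Finset.subset_union_left, fun n f x hx => ?_⟩
    exact Finset.mem_union_right _ (hfinT.mem_toFinset.2 ⟨⟨⟨n, f⟩, fun i => ⟨x i, hx i⟩⟩, rfl⟩)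
  choose T hGT hT using hT
  choose V hV using fun z : B × B => exists_support_conc (χ (Conc.principal LW z.1 z.2))
  obtain ⟨σ, hσ, hσS⟩ := hX.exists_section fun I => (T I ×ˢ T I).biUnion V
  have hmem : ∀ p, ¬ IsMax p → (σ p).1 ∈ N.nonMax XX := fun p hp => ⟨(σ p).2, by rwa [hσ p]⟩
  have hgr : ∀ p, IsGreatest (N.del '' ((σ p).1.1 : Set X)) p := fun p => by
    have := N.isGreatest_norm (σ p).1
    rwa [hσ p] at this
  have hcompat : ∀ (p q : P) (hpq : p < q) (a b : B), a ∈ T ⟨_, hmem p hpq.not_isMax⟩ →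
      b ∈ T ⟨_, hmem p hpq.not_isMax⟩ →
        Conc.map (condensateProj A _ (hgr q)) (χ (Conc.principal LW a b)) =
          Conc.map (A.map hpq.le)
            (Conc.map (condensateProj A _ (hgr p)) (χ (Conc.principal LW a b))) :=
    fun p q hpq a b ha hb => hV (a, b) _ _ p q _ _ hpq.le (σ.monotone hpq.le) fun x hx =>
      hσS p q hpq x (Finset.mem_biUnion.2 ⟨(a, b), Finset.mem_product.2 ⟨ha, hb⟩, hx⟩)
  let θ : P → Congr LW B := fun p => (hg _ p (hgr p)).congr
  -- Although `θ p ≤ θ q` may fail, the inclusion holds on the finite set `T` attached to `σ p`.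
  have hθ : ∀ (p q : P) (hpq : p < q) (a b : B), a ∈ T ⟨_, hmem p hpq.not_isMax⟩ →
      b ∈ T ⟨_, hmem p hpq.not_isMax⟩ → (θ p).proj a = (θ p).proj b →
        (θ q).proj a = (θ q).proj b := by
    intro p q hpq a b ha hb h
    rw [Congr.proj_eq, IsIdealInduced.congr_rel] at h ⊢
    rw [hcompat p q hpq a b ha hb, h, Conc.map_bot]
  have hs : ∀ p, ∃ s : (θ p).Quot → B, (∀ d, (θ p).proj (s d) = d) ∧
      ∀ (hp : ¬ IsMax p) (d), s d ∈ F ⟨_, hmem p hp⟩ := by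
    intro p
    by_cases hp : IsMax p
    -- At a maximal p the quotient may be infinite, but no proper transition map starts there, so
    -- any section will do.
    · exact ⟨_, Function.surjInv_eq (θ p).proj_surjective, fun h => absurd hp h⟩
    · choose s hs using hF ⟨_, hmem p hp⟩ p (hgr p)
      exact ⟨s, fun d => (hs d).2, fun _ d => (hs d).1⟩
  choose s hs hsF using hs
  have hsG : ∀ (p q : P) (hpq : p ≤ q) (hq : ¬ IsMax q) (d), s p d ∈ G ⟨_, hmem q hq⟩ :=
    fun p q hpq hq d => 
    have hp : ¬ IsMax p := fun hp => hq (hp.mono hpq)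
    hG ⟨_, hmem q hq⟩ ⟨_, hmem p hp⟩ (σ.monotone hpq) (hsF p hp d)
  have hmap : ∀ (p q : P) (hpq : p < q) (b : B), b ∈ T ⟨_, hmem p hpq.not_isMax⟩ →
      (θ q).proj (s p ((θ p).proj b)) = (θ q).proj b := fun p q hpq _ hb =>
    hθ p q hpq _ _ (hGT _ (hsG p p le_rfl hpq.not_isMax _)) hb (hs p _)
  let D : AlgDiagram LW P :=
    { obj := fun p => (θ p).Quot
      str := fun p => inferInstance
      map := fun {p q} hpq =>
        { toFun := fun d => (θ q).proj (s p d)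
          map_fun' := fun {n} f x => by
            obtain rfl | hpq := hpq.eq_or_lt
            · simp only [hs, Function.comp_def]
            · have hx : funMap f x = (θ p).proj (funMap f fun i => s p (x i)) := by
                rw [Hom.map_fun]
                exact congrArg _ (funext fun i => (hs p (x i)).symm)
              rw [hx, hmap p q hpq _ (hT _ n f _ fun i => hsG p p le_rfl hpq.not_isMax _),
                Hom.map_fun]
              rfl
          map_rel' := fun r => isEmptyElim r }
      map_id := fun p d => hs p d
      map_comp := fun {p q r} hpq hqr d => by
        change (θ r).proj (s q ((θ q).proj (s p d))) = (θ r).proj (s p d)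
        -- For q < r, the representative `s p d` belongs to `G` at `σ q`, so replacing it by the
        -- chosen representative of its class modulo `θ q` does not change its class modulo `θ r`.
        obtain rfl | hqr := hqr.eq_or_lt
        · rw [hs]
        · exact hmap q r hqr _ (hGT _ (hsG p q hpq hqr.not_isMax _)) }
  refine ⟨D, fun p => hB.of_surjective (θ p).proj_surjective, ?_,
    fun p => ⟨(θ p).proj, (θ p).proj_surjective⟩⟩
  choose e he using fun p => (hg _ p (hgr p)).exists_orderIso_conc
  refine ⟨e, fun p q hpq α => ?_⟩
  obtain rfl | hlt := hpq.eq_or_lt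
  · rw [Conc.map_eq_self (D.map_id p), Conc.map_eq_self (A.map_id p)]
  induction α using Conc.induction with
  | bot => simp only [Conc.map_bot, map_bot]
  | sup α β hα hβ => rw [Conc.map_sup, map_sup, hα, hβ, map_sup, Conc.map_sup]
  | principal d d' =>
    -- Both paths of the naturality square start from the same pair of representatives in B, where
    -- `hcompat` applies.
    have h₁ : Conc.principal LW d d' =
        Conc.map (θ p).proj (Conc.principal LW (s p d) (s p d')) := by
      rw [Conc.map_principal, hs, hs]
    have h₂ : Conc.map (D.map hpq) (Conc.principal LW d d') =
        Conc.map (θ q).proj (Conc.principal LW (s p d) (s p d')) := by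
      rw [Conc.map_principal, Conc.map_principal]
      rfl
    rw [h₂, he, h₁, he]
    exact hcompat p q hlt _ _ (hGT _ (hsG p p le_rfl hlt.not_isMax _))
      (hGT _ (hsG p p le_rfl hlt.not_isMax _))

end Lifting

theorem finite_conc {L : FirstOrder.Language.{u, u}} (A : Type u) [L.Structure A] [Finite A] :
    Finite (Conc L A) :=
  Finite.of_injective (fun α : Conc L A => {z : A × A | α.1.rel z.1 z.2}) fun _ _ h =>
    Subtype.ext <| Congr.ext <| funext fun x => funext fun y =>
      propext (Set.ext_iff.1 h (x, y))

end CondLift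

open CondLift
theorem theoremT {LV LW : FirstOrder.Language.{u, u}} [LV.IsAlgebraic] [LW.IsAlgebraic]
    (V : Variety LV) (W : Variety LW)
    (hfin : Finite (Σ n, LW.Functions n)) (hW : W.CongruenceProper)
    {X P : Type u} [PartialOrder X] [PartialOrder P]
    (N : NormCovering X P) (XX : Set N.SharpIdeal) (hX : N.IsLifter XX)
    (A : AlgDiagram LV P) (hA : A.IsIn V) :
    ((∀ p : P, ¬ IsMax p → Finite (Conc LV (A.obj p))) →
      ∀ (B : Type u) [LW.Structure B], W.Mem B →
        Nonempty (Conc LW B ≃o Conc LV (condensate N A)) →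
        ∃ D : AlgDiagram LW P, D.IsIn W ∧ D.LiftsConc A ∧
          ∀ p, ∃ g : B →[LW] D.obj p, Function.Surjective g) ∧
    ((∀ p : P, Finite (A.obj p)) →
      (¬ ∃ D : AlgDiagram LW P, D.IsIn W ∧ D.LiftsConc A) →
        crit V W ≤ ((ℵ₀ + #X : Cardinal.{u}) : WithTop Cardinal.{u})) := by
  refine ⟨fun hAfin B _ hB ⟨χ⟩ => exists_lifting hfin hW hX (fun p => (hA p).1) hAfin hB χ,
    fun hAfin hD => ?_⟩
  have hS : #(Conc LV (condensate N A)) ∈ critSet V W := by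
    refine ⟨Conc LV (condensate N A), inferInstance, inferInstance,
      ⟨_, _, condensate_mem hA N, ⟨OrderIso.refl _⟩⟩, ?_, rfl⟩
    rintro ⟨B, _, hB, ⟨χ⟩⟩
    obtain ⟨D, hDW, hDA, -⟩ := exists_lifting hfin hW hX (fun p => (hA p).1)
      (fun p _ => finite_conc (A.obj p)) hB χ
    exact hD ⟨D, hDW, hDA⟩
  rw [crit, if_pos ⟨_, hS⟩, WithTop.coe_le_coe]
  refine (csInf_le' hS).trans ((mk_conc_le _).trans ?_)
  have h : ℵ₀ ≤ ℵ₀ + #X := self_le_add_right _ _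
  exact Cardinal.add_le_of_le h h (mk_condensate_le N A hAfin)
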